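/- An \emph{ordered semigroup} is an abelian monoid $S$ with a translation invariant partial order whose smallest element is $0$. For $s,t\in S$ write $s\ll t$ if for every increasing sequence $(t_n)$ in $S$ that has a supremum with $t\le \sup_n t_n$ there is $n_0$ with $s\le t_{n_0}$. Consider the axioms: - \textbf{O1.} Every increasing sequence has a supremum. - \textbf{O2.} Every $s\in S$ is the supremum of a sequence $(s_n)$ with $s_n\ll s_{n+1}$ for all $n$. - \textbf{O3.} If $s_1\ll t_1$ and $s_2\ll t_2$, then $s_1+s_2\ll t_1+t_2$. - \textbf{O4.} If $(s_n)$ and $(t_n)$ are increasing sequences, then $\sup_n(s_n+t_n)=\sup_n s_n+\sup_n t_n$. - \textbf{O5.} If $s'\ll s\le t$, then there exists $r$ such that $s'+r\le t\le s+r$. A \emph{functional} on $S$ is a map $\lambda\colon S\to[0,\infty]$ that preserves $0$, addition, the order and the suprema of increasing sequences. Let $\mathrm{F}(S)$ be the cone of functionals on $S$, with pointwise addition and scalar multiplication, topologized so that a net $(\lambda_i)$ converges to $\lambda$ if and only if $\limsup_i\lambda_i(s')\le\lambda(s)\le\liminf_i\lambda_i(s)$ for all $s'\ll s$ in $S$.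 For $s\in S$ let $\hat s\colon \mathrm{F}(S)\to[0,\infty]$, $\hat s(\lambda)=\lambda(s)$. Let $S_{\mathbb R}$ be the set of functions $f\colon \mathrm{F}(S)\to[0,\infty]$ for which there are $s_i\in S$ and integers $n_i\ge 1$ ($i=1,2,\dots$) such that the sequence $(\hat s_i/n_i)_i$ is pointwise increasing and $f(\lambda)=\sup_i \hat s_i(\lambda)/n_i$ for all $\lambda\in \mathrm{F}(S)$; it is an ordered semigroup under pointwise addition and pointwise order. \textbf{Proposition.} Let $S$ be an ordered semigroup satisfying O1–O5. Then $S_{\mathbb R}$ also satisfies O1–O5. Moreover $\mathrm{F}(S)\cong \mathrm{F}(S_{\mathbb R})$ as topological cones: the map $\lambda\mapsto(f\mapsto f(\lambda))$ is a linear homeomorphism from $\mathrm{F}(S)$ onto $\mathrm{F}(S_{\mathbb R})$. -/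

import Mathlib

open scoped NNReal ENNReal Topology
open Filter Set

namespace CuSemigroup

/-! An *ordered semigroup* is an abelian monoid with a translation invariant partial order
whose smallest element is `0`. It is expressed by the Mathlib classes
`[AddCommMonoid S] [PartialOrder S] [IsOrderedAddMonoid S] [IsBotZeroClass S]`. -/

section Axioms

variable {S : Type*} [PartialOrder S]

/-- `s` is (sequentially) compactly contained in `t`: whenever `t` is below the supremum of an
increasing sequence, `s` is below some term of that sequence. -/
def CompactlyContained (s t : S) : Prop :=
  ∀ (u : ℕ → S) (x : S), Monotone u → IsLUB (range u) x → t ≤ x → ∃ n, s ≤ u n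

/-- The axioms O1-O4 (objects of the category Cu) together with O5 (almost algebraic order). -/
structure SatisfiesO1O5 (S : Type*) [AddCommMonoid S] [PartialOrder S] : Prop where
  /-- Every increasing sequence has a supremum. -/
  o1 : ∀ u : ℕ → S, Monotone u → ∃ x, IsLUB (range u) x
  /-- Every element is the supremum of a rapidly increasing sequence. -/
  o2 : ∀ s : S, ∃ u : ℕ → S,
    (∀ n, CompactlyContained (u n) (u (n + 1))) ∧ IsLUB (range u) s
  /-- Compact containment is compatible with addition. -/
  o3 : ∀ s₁ t₁ s₂ t₂ : S, CompactlyContained s₁ t₁ → CompactlyContained s₂ t₂ →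
    CompactlyContained (s₁ + s₂) (t₁ + t₂)
  /-- Suprema of increasing sequences are compatible with addition. -/
  o4 : ∀ (u v : ℕ → S) (x y : S), Monotone u → Monotone v →
    IsLUB (range u) x → IsLUB (range v) y → IsLUB (range fun n => u n + v n) (x + y)
  /-- Almost algebraic order. -/
  o5 : ∀ s' s t : S, CompactlyContained s' s → s ≤ t → ∃ r, s' + r ≤ t ∧ t ≤ s + r

theorem CompactlyContained.trans_le {s t t' : S} (h : CompactlyContained s t) (ht : t ≤ t') :
    CompactlyContained s t' :=
  fun u x hu hx hle => h u x hu hx (ht.trans hle)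

theorem CompactlyContained.le {s t : S} (h : CompactlyContained s t) : s ≤ t := by
  obtain ⟨_, hn⟩ := h (fun _ => t) t monotone_const (by simp) le_rfl
  exact hn

end Axioms

noncomputable section Functionals

/-- A functional on `S`: a map `S → [0, ∞]` that preserves `0`, addition, the order, and the
suprema of increasing sequences. -/
structure Functional (S : Type*) [AddCommMonoid S] [PartialOrder S] where
  /-- The underlying function. -/
  toFun : S → ℝ≥0∞
  map_zero' : toFun 0 = 0
  map_add' : ∀ s t, toFun (s + t) = toFun s + toFun t
  monotone' : Monotone toFun
  map_sup' : ∀ (u : ℕ → S) (x : S), Monotone u → IsLUB (range u) x →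
    toFun x = ⨆ n, toFun (u n)

variable {S : Type*} [AddCommMonoid S] [PartialOrder S]

namespace Functional

instance : FunLike (Functional S) S ℝ≥0∞ where
  coe := toFun
  coe_injective := by
    rintro ⟨f, _, _, _, _⟩ ⟨g, _, _, _, _⟩ h
    cases h
    rfl

/-- The zero functional. -/
instance : Zero (Functional S) where
  zero :=
    { toFun := fun _ => 0
      map_zero' := rfl
      map_add' := by simp
      monotone' := monotone_const
      map_sup' := by simp }

/-- Pointwise addition of functionals. -/
instance : Add (Functional S) where
  add f g :=
    { toFun := fun s => f.toFun s + g.toFun s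
      map_zero' := by rw [f.map_zero', g.map_zero', add_zero]
      map_add' := fun s t => by rw [f.map_add', g.map_add', add_add_add_comm]
      monotone' := f.monotone'.add g.monotone'
      map_sup' := fun u x hu hx => by
        rw [f.map_sup' u x hu hx, g.map_sup' u x hu hx]
        exact ENNReal.iSup_add_iSup_of_monotone (f.monotone'.comp hu) (g.monotone'.comp hu) }

/-- Pointwise scalar multiplication of functionals (with the convention `0 * ∞ = 0`, so that
`0 • f` is the zero functional). -/
instance : SMul ℝ≥0 (Functional S) where
  smul c f :=
    { toFun := fun s => (c : ℝ≥0∞) * f.toFun s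
      map_zero' := by rw [f.map_zero', mul_zero]
      map_add' := fun s t => by rw [f.map_add', mul_add]
      monotone' := fun s t h => by
        have := f.monotone' h
        dsimp only
        gcongr
      map_sup' := fun u x hu hx => by
        rw [f.map_sup' u x hu hx, ENNReal.mul_iSup] }

/-- The pointwise sum of `n` copies of a functional; it agrees with the scalar multiple. -/
instance : SMul ℕ (Functional S) where
  smul n f := (n : ℝ≥0) • f

@[simp] theorem zero_apply (s : S) : (0 : Functional S) s = 0 := rfl

@[simp] theorem add_apply (f g : Functional S) (s : S) : (f + g) s = f s + g s := rfl

@[simp] theorem smul_apply (c : ℝ≥0) (f : Functional S) (s : S) :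
    (c • f) s = (c : ℝ≥0∞) * f s := rfl

instance : AddCommMonoid (Functional S) :=
  DFunLike.coe_injective.addCommMonoid (fun f : Functional S => (f : S → ℝ≥0∞)) rfl
    (fun _ _ => rfl) (fun f n => by
      funext s
      change ((n : ℝ≥0) : ℝ≥0∞) * f s = n • f s
      simp)

/-- The cone of functionals, as a module over the semiring of nonnegative real numbers. -/
instance : Module ℝ≥0 (Functional S) :=
  DFunLike.coe_injective.module ℝ≥0
    ({ toFun := fun f => (f : S → ℝ≥0∞)
       map_zero' := rfl
       map_add' := fun _ _ => rfl } : Functional S →+ (S → ℝ≥0∞))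
    (fun _ _ => rfl)

/-- The topology on the cone of functionals. Its convergent nets are described in
`tendsto_nhds_iff`. -/
instance : TopologicalSpace (Functional S) :=
  TopologicalSpace.generateFrom
    ({U | ∃ (s : S) (a : ℝ≥0∞), U = {f : Functional S | a < f s}} ∪
      {U | ∃ (s' : S) (b : ℝ≥0∞),
        U = {f : Functional S | ∃ s, CompactlyContained s' s ∧ f s < b}})

/-- A net (here: a function along a filter) `φ` of functionals converges to `f` if and only if
`limsup φ(s') ≤ f(s) ≤ liminf φ(s)` whenever `s'` is compactly contained in `s`. -/
theorem tendsto_nhds_iff (hS : SatisfiesO1O5 S) {ι : Type*} {l : Filter ι}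
    {φ : ι → Functional S} {f : Functional S} :
    Tendsto φ l (𝓝 f) ↔ ∀ s' s : S, CompactlyContained s' s →
      limsup (fun i => φ i s') l ≤ f s ∧ f s ≤ liminf (fun i => φ i s) l := by
  rw [TopologicalSpace.tendsto_nhds_generateFrom_iff]
  constructor
  · intro h s' s hs
    constructor
    · refine le_of_forall_gt fun b hb => ?_
      obtain ⟨c, hc, hcb⟩ := exists_between hb
      have := h _ (Or.inr ⟨s', c, rfl⟩) ⟨s, hs, hc⟩
      refine lt_of_le_of_lt (limsup_le_of_le (by isBoundedDefault) ?_) hcb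
      filter_upwards [this] with i hi
      obtain ⟨t, ht, hit⟩ := hi
      exact ((φ i).monotone' ht.le).trans hit.le
    · refine le_of_forall_lt fun a ha => ?_
      obtain ⟨c, hac, hc⟩ := exists_between ha
      have := h _ (Or.inl ⟨s, c, rfl⟩) hc
      refine lt_of_lt_of_le hac (le_liminf_of_le (by isBoundedDefault) ?_)
      filter_upwards [this] with i hi
      exact le_of_lt hi
  · rintro h U (⟨s, a, rfl⟩ | ⟨s', b, rfl⟩) hf
    · obtain ⟨u, hu, hus⟩ := hS.o2 s
      have hmono : Monotone u := monotone_nat_of_le_succ fun n => (hu n).le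
      have hf' : a < ⨆ n, f (u n) := by
        have := f.map_sup' u s hmono hus
        exact this ▸ hf
      obtain ⟨n, hn⟩ := lt_iSup_iff.mp hf'
      have := (h _ _ (hu n)).2
      have hlt : a < liminf (fun i => φ i (u (n + 1))) l :=
        lt_of_lt_of_le (lt_of_lt_of_le hn (f.monotone' (hu n).le)) this
      filter_upwards [eventually_lt_of_lt_liminf hlt] with i hi
      exact lt_of_lt_of_le hi ((φ i).monotone' (hus.1 ⟨n + 1, rfl⟩))
    · obtain ⟨s, hs, hsb⟩ := hf
      obtain ⟨u, hu, hus⟩ := hS.o2 s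
      have hmono : Monotone u := monotone_nat_of_le_succ fun n => (hu n).le
      obtain ⟨n, hn⟩ := hs u s hmono hus le_rfl
      have h2 : CompactlyContained (u (n + 2)) s := (hu (n + 2)).trans_le (hus.1 ⟨_, rfl⟩)
      have h1 : CompactlyContained s' (u (n + 2)) := by
        intro v x hv hx hle
        obtain ⟨m, hm⟩ := ((hu n).trans_le (hu (n + 1)).le) v x hv hx hle
        exact ⟨m, hn.trans hm⟩
      filter_upwards [eventually_lt_of_limsup_lt (lt_of_le_of_lt (h _ _ h2).1 hsb)] with i hi
      exact ⟨_, h1, hi⟩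

end Functional

end Functionals

section Realification

variable (S : Type*) [AddCommMonoid S] [PartialOrder S]

/-- `Lsc(F(S))`: the linear, lower semicontinuous functions `F(S) → [0, ∞]`, with pointwise
addition and pointwise order. -/
def Lsc : AddSubmonoid (Functional S → ℝ≥0∞) where
  carrier := {f | LowerSemicontinuous f ∧ f 0 = 0 ∧ (∀ x y, f (x + y) = f x + f y) ∧
    ∀ (c : ℝ≥0) (x), 0 < c → f (c • x) = (c : ℝ≥0∞) * f x}
  zero_mem' := ⟨lowerSemicontinuous_const, by simp⟩
  add_mem' := by
    rintro f g ⟨hf, hf0, hfa, hfc⟩ ⟨hg, hg0, hga, hgc⟩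
    refine ⟨hf.add hg, by simp [hf0, hg0], fun x y => ?_, fun c x hc => ?_⟩
    · simp only [Pi.add_apply, hfa, hga]
      exact add_add_add_comm _ _ _ _
    · simp only [Pi.add_apply, hfc c x hc, hgc c x hc, mul_add]

/-- The realification of `S`: the functions `f` on `F(S)` that are the pointwise supremum of an
increasing sequence `(ŝᵢ / nᵢ)`, with `sᵢ` in `S` and `nᵢ ≥ 1` natural numbers, where
`ŝ(x) = x(s)`. The order and the addition are the pointwise ones. All these functions are in
`Lsc(F(S))`, see `realification_le_Lsc`. -/
def realification : AddSubmonoid (Functional S → ℝ≥0∞) where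
  carrier := {f | ∃ (s : ℕ → S) (n : ℕ → ℕ+),
    (Monotone fun i => fun x : Functional S => x (s i) / (n i : ℝ≥0∞)) ∧
      ∀ x : Functional S, f x = ⨆ i, x (s i) / (n i : ℝ≥0∞)}
  zero_mem' := by
    refine ⟨fun _ => 0, fun _ => 1, monotone_const, fun x => ?_⟩
    have : x 0 = 0 := x.map_zero'
    simp [this]
  add_mem' := by
    rintro f g ⟨s, n, hs, hf⟩ ⟨t, m, ht, hg⟩
    have key : ∀ (i : ℕ) (x : Functional S),
        x ((m i : ℕ) • s i + (n i : ℕ) • t i) / ((n i * m i : ℕ+) : ℝ≥0∞) =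
          x (s i) / (n i : ℝ≥0∞) + x (t i) / (m i : ℝ≥0∞) := by
      intro i x
      have hx : ∀ (k : ℕ) (r : S), x (k • r) = (k : ℝ≥0∞) * x r := by
        intro k r
        let φ : S →+ ℝ≥0∞ := ⟨⟨x, x.map_zero'⟩, x.map_add'⟩
        exact (map_nsmul φ k r).trans (nsmul_eq_mul _ _)
      have ha : x ((m i : ℕ) • s i + (n i : ℕ) • t i) =
          (m i : ℝ≥0∞) * x (s i) + (n i : ℝ≥0∞) * x (t i) := by
        rw [← hx, ← hx]
        exact x.map_add' _ _
      have hn0 : (n i : ℝ≥0∞) ≠ 0 := by simp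
      have hm0 : (m i : ℝ≥0∞) ≠ 0 := by simp
      have hn1 : (n i : ℝ≥0∞) ≠ ∞ := by simp
      have hm1 : (m i : ℝ≥0∞) ≠ ∞ := by simp
      have hc : ((n i * m i : ℕ+) : ℝ≥0∞) = (n i : ℝ≥0∞) * (m i : ℝ≥0∞) := by push_cast; rfl
      rw [ha, hc, ENNReal.add_div, ENNReal.mul_div_mul_left _ _ hn0 hn1,
        mul_comm (n i : ℝ≥0∞) (m i : ℝ≥0∞), ENNReal.mul_div_mul_left _ _ hm0 hm1]
    refine ⟨fun i => (m i : ℕ) • s i + (n i : ℕ) • t i, fun i => n i * m i, ?_, fun x => ?_⟩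
    · simp only [key]
      exact hs.add ht
    · simp only [key, Pi.add_apply, hf, hg]
      exact ENNReal.iSup_add_iSup_of_monotone (fun i j h => hs h x) (fun i j h => ht h x)

theorem realification_le_Lsc : realification S ≤ Lsc S := by
  rintro f ⟨s, n, hs, hf⟩
  have hm : ∀ x : Functional S, Monotone fun i => x (s i) / (n i : ℝ≥0∞) :=
    fun x i j h => hs h x
  refine ⟨?_, ?_, fun x y => ?_, fun c x _ => ?_⟩
  · have : f = fun x => ⨆ i, x (s i) / (n i : ℝ≥0∞) := funext hf
    rw [this]
    refine lowerSemicontinuous_iSup fun i => ?_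
    have h1 : LowerSemicontinuous fun x : Functional S => x (s i) := by
      rw [lowerSemicontinuous_iff_isOpen_preimage]
      intro a
      exact TopologicalSpace.isOpen_generateFrom_of_mem (Or.inl ⟨s i, a, rfl⟩)
    refine (ENNReal.continuous_div_const _ ?_).comp_lowerSemicontinuous h1 ?_
    · simp
    · intro a b h
      dsimp only
      gcongr
  · simp [hf]
  · simp only [hf, Functional.add_apply, ENNReal.add_div]
    exact (ENNReal.iSup_add_iSup_of_monotone (hm x) (hm y)).symm
  · simp only [hf, Functional.smul_apply, mul_div_assoc, ENNReal.mul_iSup]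

instance : IsBotZeroClass (realification S) where
  isBot_zero _ := fun _ => zero_le

end Realification

end CuSemigroup

/-! Compact containment in `realification S` is controlled by the compactness of F(S). For f and g
on F(S), `WayBelow f g` says that f ≤ c·f' with c < 1 and f' homogeneous, where the values of f'
near each x are at most g(x) in the limit. If g is below the supremum of an increasing sequence of
elements of `Lsc S` and no term dominates f, then rescaled witnesses of failure have a cluster
point, which is contradictory (`WayBelow.exists_le`).

With this relation a diagonal argument (`WayBelow.exists_diagonal`) shows that pointwise suprema of
increasing sequences stay in the realification, so order suprema are pointwise. This gives O1, O2
and O4. It also identifies `WayBelow` with compact containment, which gives O3 because `WayBelow` is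
additive.

O5 needs a passage from inequalities on F(S) back to S: if ŝ ≤ c·t̂ with c < 1 and s' ≪ s, then n•s'
≤ n•t for some n > 0 (`exists_nsmul_le_nsmul`). Otherwise a Hahn–Banach argument gives an additive
monotone map separating s' from t, and regularizing it gives a functional violating ŝ ≤ c·t̂. O5 in
S then yields complements for the functions ŝ/n. They are arranged to increase, and their supremum
is the complement sought (`exists_complement`).

A functional on the realification is determined by its values on the ŝ, so restriction along s ↦ ŝ
inverts evaluation. Continuity both ways follows from the description of ≪ by `WayBelow`. -/

namespace CuSemigroup

/-! ### Hahn–Banach for monotone sublinear maps into [0, ∞]. -/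

section Sublinear

variable {P : Type*} [AddCommMonoid P] [PartialOrder P]

/-- Monotone, subadditive and `ℕ`-homogeneous maps into `[0, ∞]`. -/
structure IsSublinear (p : P → ℝ≥0∞) : Prop where
  monotone : Monotone p
  add_le : ∀ x y, p (x + y) ≤ p x + p y
  map_nsmul : ∀ (k : ℕ) (x : P), p (k • x) = k * p x

theorem IsSublinear.map_zero {p : P → ℝ≥0∞} (hp : IsSublinear p) : p 0 = 0 := by
  simpa using hp.map_nsmul 0 0

/-- A modification of `p` from below that is additive in the direction `y` when `p` is sublinear. -/
noncomputable def sublinearShift (p : P → ℝ≥0∞) (y x : P) : ℝ≥0∞ :=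
  ⨅ k : ℕ, (p (x + k • y) - k * p y)

omit [PartialOrder P] in
theorem sublinearShift_le (p : P → ℝ≥0∞) (y x : P) : sublinearShift p y x ≤ p x :=
  (iInf_le _ 0).trans (by simp)

variable [IsOrderedAddMonoid P] [IsBotZeroClass P]

namespace IsSublinear

variable {p : P → ℝ≥0∞}

theorem nsmul_le (hp : IsSublinear p) (x y : P) (k : ℕ) : k * p y ≤ p (x + k • y) := by
  rw [← hp.map_nsmul]
  exact hp.monotone (le_add_of_nonneg_left zero_le)

theorem sub_add_nsmul (hp : IsSublinear p) (x y : P) (k : ℕ) :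
    p (x + k • y) - k * p y + k * p y = p (x + k • y) :=
  tsub_add_cancel_of_le (hp.nsmul_le x y k)

theorem shift_antitone (hp : IsSublinear p) {y : P} (x : P) :
    Antitone fun k : ℕ => p (x + k • y) - k * p y := by
  refine antitone_nat_of_succ_le fun k => ?_
  rw [tsub_le_iff_right, Nat.cast_succ, add_mul, one_mul, ← add_assoc, hp.sub_add_nsmul,
    succ_nsmul, ← add_assoc]
  exact hp.add_le _ _

/-- The truncated subtraction is harmless because k·p(y) ≤ p(x + k•y). In the homogeneity proof only
indices divisible by k occur on one side; they suffice by `shift_antitone`. -/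
theorem shift (hp : IsSublinear p) (y : P) :
    IsSublinear (sublinearShift p y) where
  monotone x x' h := iInf_mono fun k => tsub_le_tsub_right (hp.monotone (by gcongr)) _
  add_le x x' := by
    simp only [sublinearShift, ENNReal.iInf_add, ENNReal.add_iInf]
    refine le_iInf fun i => le_iInf fun j => (iInf_le _ (j + i)).trans ?_
    rw [tsub_le_iff_right]
    calc p (x + x' + (j + i) • y) = p ((x + j • y) + (x' + i • y)) := by
          rw [add_nsmul, add_add_add_comm]
      _ ≤ p (x + j • y) + p (x' + i • y) := hp.add_le _ _
      _ = (p (x + j • y) - j * p y + j * p y) + (p (x' + i • y) - i * p y + i * p y) := by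
          rw [hp.sub_add_nsmul, hp.sub_add_nsmul]
      _ = _ := by
          push_cast
          ring
  map_nsmul k x := by
    rcases Nat.eq_zero_or_pos k with rfl | hk
    · simp only [zero_nsmul, Nat.cast_zero, zero_mul]
      exact le_antisymm ((sublinearShift_le p y 0).trans hp.map_zero.le) zero_le
    have key : ∀ j : ℕ, (k : ℝ≥0∞) * (p (x + j • y) - j * p y) =
        p (k • x + (k * j) • y) - (k * j : ℕ) * p y := by
      intro j
      rw [ENNReal.mul_sub (fun _ _ => by simp), ← hp.map_nsmul, nsmul_add, mul_nsmul']
      push_cast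
      rw [mul_assoc]
    have hk0 : (k : ℝ≥0∞) ≠ 0 := by exact_mod_cast hk.ne'
    rw [sublinearShift, sublinearShift, ENNReal.mul_iInf_of_ne hk0 (by simp)]
    simp only [key]
    refine le_antisymm (le_iInf fun j => iInf_le _ (k * j)) (le_iInf fun j => (iInf_le _ j).trans ?_)
    exact hp.shift_antitone (k • x) (Nat.le_mul_of_pos_left j hk)

theorem shift_add_self (hp : IsSublinear p) {y : P} (hy : p y ≠ ∞) (x : P) :
    sublinearShift p y (x + y) = sublinearShift p y x + p y := by
  simp only [sublinearShift, ENNReal.iInf_add]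
  have key : ∀ k : ℕ, p (x + y + k • y) - k * p y =
      p (x + (k + 1) • y) - (k + 1 : ℕ) * p y + p y := by
    intro k
    have h2 : (k : ℝ≥0∞) * p y ≠ ∞ := ENNReal.mul_ne_top (by simp) hy
    rw [add_assoc x, ← succ_nsmul']
    refine ENNReal.sub_eq_of_eq_add h2 ?_
    calc p (x + (k + 1) • y)
        = p (x + (k + 1) • y) - (k + 1 : ℕ) * p y + (k + 1 : ℕ) * p y :=
          (hp.sub_add_nsmul x y (k + 1)).symm
      _ = _ := by
          rw [Nat.cast_succ, add_mul, one_mul, add_right_comm, ← add_assoc]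
  simp only [key]
  refine le_antisymm (le_iInf fun k => (iInf_le _ k).trans ?_) (le_iInf fun k => iInf_le _ (k + 1))
  gcongr ?_ + _
  exact hp.shift_antitone x k.le_succ

/-- A sublinear map dominates an additive one agreeing with it at a given point. -/
theorem exists_additive (hp : IsSublinear p) (a : P) :
    ∃ q : P → ℝ≥0∞, Monotone q ∧ q 0 = 0 ∧ (∀ x y, q (x + y) = q x + q y) ∧ (∀ x, q x ≤ p x) ∧
      q a = p a := by
  -- Additivity in the direction a is imposed at every x: the single equation q(a) = p(a) need not
  -- survive a shift by another element. The order dual turns Zorn's maximal elements into minimal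
  -- maps.
  let Q : Set (P → ℝ≥0∞)ᵒᵈ :=
    {q | IsSublinear (OrderDual.ofDual q) ∧
      ∀ x, OrderDual.ofDual q (x + a) = OrderDual.ofDual q x + p a}
  have hstart : ∃ q ∈ Q, OrderDual.ofDual q ≤ p := by
    by_cases ha : p a = ∞
    · refine ⟨OrderDual.toDual p, ⟨hp, fun x => ?_⟩, le_rfl⟩
      simp only [OrderDual.ofDual_toDual, ha, add_top]
      exact top_le_iff.1 (ha ▸ hp.monotone (le_add_of_nonneg_left zero_le))
    · exact ⟨OrderDual.toDual (sublinearShift p a), ⟨hp.shift a, hp.shift_add_self ha⟩,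
        sublinearShift_le p a⟩
  obtain ⟨q₀, hq₀, hq₀p⟩ := hstart
  obtain ⟨q, hq₀q, hq⟩ := zorn_le_nonempty₀ Q (by
    intro c hcQ hc y hy
    have : Nonempty c := ⟨⟨y, hy⟩⟩
    -- Directedness of the chain is what lets the infimum commute with sums.
    have dir : ∀ (x x' : P) (i j : c), ∃ k : c, OrderDual.ofDual k.1 x + OrderDual.ofDual k.1 x' ≤
        OrderDual.ofDual i.1 x + OrderDual.ofDual j.1 x' := by
      intro x x' i j
      rcases hc.total i.2 j.2 with h | h
      · exact ⟨j, add_le_add (h x) le_rfl⟩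
      · exact ⟨i, add_le_add le_rfl (h x')⟩
    refine ⟨OrderDual.toDual fun x => ⨅ r : c, OrderDual.ofDual r.1 x, ⟨⟨?_, ?_, ?_⟩, ?_⟩, ?_⟩
    · exact fun x x' h => iInf_mono fun r => (hcQ r.2).1.monotone h
    · intro x x'
      change (⨅ r : c, OrderDual.ofDual r.1 (x + x')) ≤
        (⨅ r : c, OrderDual.ofDual r.1 x) + ⨅ r : c, OrderDual.ofDual r.1 x'
      rw [ENNReal.iInf_add_iInf (dir x x')]
      exact iInf_mono fun r => (hcQ r.2).1.add_le x x'
    · intro k x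
      change (⨅ r : c, OrderDual.ofDual r.1 (k • x)) = k * ⨅ r : c, OrderDual.ofDual r.1 x
      rcases Nat.eq_zero_or_pos k with rfl | hk
      · simp [fun r : c => (hcQ r.2).1.map_zero]
      · rw [ENNReal.mul_iInf_of_ne (by exact_mod_cast hk.ne') (by simp)]
        exact iInf_congr fun r => (hcQ r.2).1.map_nsmul k x
    · intro x
      change (⨅ r : c, OrderDual.ofDual r.1 (x + a)) = (⨅ r : c, OrderDual.ofDual r.1 x) + p a
      rw [ENNReal.iInf_add]
      exact iInf_congr fun r => (hcQ r.2).2 x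
    · intro z hz x
      exact iInf_le (fun r : c => OrderDual.ofDual r.1 x) ⟨z, hz⟩) q₀ hq₀
  have hqs := hq.prop.1
  refine ⟨OrderDual.ofDual q, hqs.monotone, hqs.map_zero, fun x y => ?_,
    fun x => (hq₀q x).trans (hq₀p x), ?_⟩
  · refine le_antisymm (hqs.add_le x y) ?_
    have hmono : OrderDual.ofDual q y ≤ OrderDual.ofDual q (x + y) :=
      hqs.monotone (le_add_of_nonneg_left zero_le)
    by_cases hy : OrderDual.ofDual q y = ∞
    · rw [hy, top_le_iff] at hmono
      rw [hmono]
      exact le_top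
    -- The shift of q by y lies in Q and below q, so minimality gives q(x) ≤ q(x + y) - q(y), the
    -- missing half of additivity.
    · have hmem : OrderDual.toDual (sublinearShift (OrderDual.ofDual q) y) ∈ Q := by
        refine ⟨hqs.shift y, fun x => ?_⟩
        simp only [OrderDual.ofDual_toDual, sublinearShift, ENNReal.iInf_add]
        refine iInf_congr fun k => ?_
        have h2 : (k : ℝ≥0∞) * OrderDual.ofDual q y ≠ ∞ := ENNReal.mul_ne_top (by simp) hy
        rw [add_right_comm, hq.prop.2]
        exact AddLECancellable.tsub_add_eq_add_tsub (ENNReal.cancel_of_ne h2)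
          (hqs.nsmul_le x y k) |>.symm
      have hle := hq.le_of_ge hmem (fun x => sublinearShift_le (OrderDual.ofDual q) y x) x
      have h1 : OrderDual.ofDual q x ≤ OrderDual.ofDual q (x + y) - OrderDual.ofDual q y :=
        (show OrderDual.ofDual q x ≤ sublinearShift (OrderDual.ofDual q) y x from hle).trans
          ((iInf_le _ 1).trans (by simp))
      exact add_le_of_le_tsub_right_of_le hmono h1
  · have := hq.prop.2 0
    rwa [zero_add, hqs.map_zero, zero_add] at this

end IsSublinear

/-- The gauge of the order ideal generated by `b`. -/
noncomputable def orderGauge (b x : P) : ℝ≥0∞ :=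
  ⨅ (n : ℕ) (m : ℕ+) (_ : (m : ℕ) • x ≤ n • b), (n : ℝ≥0∞) / (m : ℕ)

omit [IsOrderedAddMonoid P] [IsBotZeroClass P] in
theorem orderGauge_le {b x : P} {n : ℕ} {m : ℕ+} (h : (m : ℕ) • x ≤ n • b) :
    orderGauge b x ≤ (n : ℝ≥0∞) / (m : ℕ) :=
  iInf_le_of_le n (iInf_le_of_le m (iInf_le_of_le h le_rfl))

-- Sums are handled by a common denominator. Allowing multiples of x gives homogeneity, since
-- m•(k•x) ≤ n•b is a relation for x with denominator m·k.
omit [IsBotZeroClass P] in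
theorem isSublinear_orderGauge (b : P) : IsSublinear (orderGauge b) where
  monotone x y hxy := le_iInf fun n => le_iInf fun m => le_iInf fun h =>
    orderGauge_le ((nsmul_le_nsmul_right hxy _).trans h)
  add_le x y := by
    conv_rhs => simp only [orderGauge]
    simp only [ENNReal.iInf_add, ENNReal.add_iInf]
    refine le_iInf fun n => le_iInf fun m => le_iInf fun h => le_iInf fun n' => le_iInf fun m' =>
      le_iInf fun h' => ?_
    refine (orderGauge_le (n := m * n' + m' * n) (m := m * m') ?_).trans ?_
    · rw [PNat.mul_coe, nsmul_add, add_nsmul]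
      refine add_le_add ?_ ?_
      · rw [mul_nsmul', mul_nsmul']
        exact nsmul_le_nsmul_right h' _
      · rw [mul_comm, mul_nsmul', mul_nsmul']
        exact nsmul_le_nsmul_right h _
    · have hm0 : ((m : ℕ) : ℝ≥0∞) ≠ 0 := by simp
      have hm0' : ((m' : ℕ) : ℝ≥0∞) ≠ 0 := by simp
      rw [PNat.mul_coe]
      push_cast
      rw [ENNReal.add_div, ENNReal.mul_div_mul_left _ _ hm0 (by simp),
        mul_comm (m : ℝ≥0∞), ENNReal.mul_div_mul_left _ _ hm0' (by simp)]
  map_nsmul k x := by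
    rcases Nat.eq_zero_or_pos k with rfl | hk
    · simp only [zero_nsmul, Nat.cast_zero, zero_mul]
      exact le_antisymm ((orderGauge_le (n := 0) (m := 1) (by simp)).trans (by simp)) zero_le
    have hk0 : (k : ℝ≥0∞) ≠ 0 := by exact_mod_cast hk.ne'
    refine le_antisymm ?_ ?_
    · conv_rhs => simp only [orderGauge]
      simp only [ENNReal.mul_iInf_of_ne hk0 (ENNReal.natCast_ne_top k)]
      refine le_iInf fun n => le_iInf fun m => le_iInf fun h => ?_
      refine (orderGauge_le (n := k * n) (m := m) ?_).trans ?_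
      · rw [← mul_nsmul', mul_comm (m : ℕ), mul_nsmul', mul_nsmul']
        exact nsmul_le_nsmul_right h k
      · push_cast
        rw [mul_div_assoc]
    · conv_rhs => simp only [orderGauge]
      refine le_iInf fun n => le_iInf fun m => le_iInf fun h => ?_
      have h' : ((m * k.toPNat hk : ℕ+) : ℕ) • x ≤ n • b := by
        rw [PNat.mul_coe, Nat.toPNat, PNat.mk_coe, mul_nsmul']
        exact h
      refine (mul_le_mul_right (orderGauge_le h') _).trans ?_
      rw [PNat.mul_coe, Nat.toPNat, PNat.mk_coe, Nat.cast_mul, ← mul_div_assoc, mul_comm (m : ℝ≥0∞),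
        ENNReal.mul_div_mul_left _ _ hk0 (by simp)]

/-- If no multiple of `a` is below the same multiple of `b`, some additive monotone map separates
`a` from `b`. -/
theorem exists_additive_separating {a b : P} (h : ∀ n : ℕ, 0 < n → ¬ n • a ≤ n • b) :
    ∃ q : P → ℝ≥0∞, Monotone q ∧ q 0 = 0 ∧ (∀ x y, q (x + y) = q x + q y) ∧ 1 ≤ q a ∧ q b ≤ 1 := by
  obtain ⟨q, hm, h0, hadd, hle, ha⟩ := (isSublinear_orderGauge b).exists_additive a
  refine ⟨q, hm, h0, hadd, ?_, (hle b).trans ((orderGauge_le (n := 1) (m := 1) (by simp)).trans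
    (by simp))⟩
  rw [ha]
  refine le_iInf fun n => le_iInf fun m => le_iInf fun hmn => ?_
  have hlt : (m : ℕ) ≤ n := by
    by_contra! hlt
    exact h m m.pos (hmn.trans (nsmul_le_nsmul_left zero_le hlt.le))
  rw [ENNReal.le_div_iff_mul_le (by simp) (by simp), one_mul]
  exact_mod_cast hlt

end Sublinear

/-! ### Regularization of additive maps and compactness of F(S). -/

section CompactContainment

variable {S : Type*} [AddCommMonoid S] [PartialOrder S]

omit [AddCommMonoid S] in
theorem CompactlyContained.of_le {r s t : S} (hrs : r ≤ s) (h : CompactlyContained s t) :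
    CompactlyContained r t := by
  intro u x hu hx hle
  obtain ⟨n, hn⟩ := h u x hu hx hle
  exact ⟨n, hrs.trans hn⟩

theorem SatisfiesO1O5.exists_rapid (hS : SatisfiesO1O5 S) (s : S) : ∃ u : ℕ → S, Monotone u ∧
    (∀ n, CompactlyContained (u n) (u (n + 1))) ∧ (∀ n, CompactlyContained (u n) s) ∧
      IsLUB (range u) s := by
  obtain ⟨u, hu, hs⟩ := hS.o2 s
  exact ⟨u, monotone_nat_of_le_succ fun n => (hu n).le, hu,
    fun n => (hu n).trans_le (hs.1 ⟨n + 1, rfl⟩), hs⟩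

theorem CompactlyContained.exists_between (hS : SatisfiesO1O5 S) {s t : S}
    (h : CompactlyContained s t) : ∃ r, CompactlyContained s r ∧ CompactlyContained r t := by
  obtain ⟨u, hm, hu, hut, hlub⟩ := hS.exists_rapid t
  obtain ⟨n, hn⟩ := h u t hm hlub le_rfl
  exact ⟨u (n + 1), (hu n).of_le hn, hut _⟩

variable [IsBotZeroClass S]

theorem compactlyContained_zero (s : S) : CompactlyContained 0 s :=
  fun _ _ _ _ _ => ⟨0, zero_le⟩

theorem CompactlyContained.nsmul (hS : SatisfiesO1O5 S) {s t : S} (h : CompactlyContained s t)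
    (k : ℕ) : CompactlyContained (k • s) (k • t) := by
  induction k with
  | zero => simpa using compactlyContained_zero _
  | succ k ih => simpa [succ_nsmul] using hS.o3 _ _ _ _ ih h

/-- The largest functional below an additive monotone map. -/
theorem exists_functional_le [IsOrderedAddMonoid S] (hS : SatisfiesO1O5 S) {q : S → ℝ≥0∞} (hm : Monotone q)
    (h0 : q 0 = 0) (hadd : ∀ s t, q (s + t) = q s + q t) :
    ∃ x : Functional S, (∀ s, x s ≤ q s) ∧ ∀ s' s, CompactlyContained s' s → q s' ≤ x s := by
  have hle : ∀ s' s : S, CompactlyContained s' s →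
      q s' ≤ ⨆ (r : S) (_ : CompactlyContained r s), q r :=
    fun s' s h => le_iSup₂_of_le s' h le_rfl
  refine ⟨{ toFun := fun s => ⨆ (r : S) (_ : CompactlyContained r s), q r
            map_zero' := ?_
            map_add' := fun s t => ?_
            monotone' := fun s t hst => ?_
            map_sup' := fun u x hu hx => ?_ }, fun s => iSup₂_le fun r hr => hm hr.le, hle⟩
  · exact le_antisymm (iSup₂_le fun r hr => (hm hr.le).trans h0.le) zero_le
  -- O4 gives the upper bound for the value at a sum, O3 the lower bound.
  · refine le_antisymm (iSup₂_le fun r hr => ?_) ?_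
    · obtain ⟨u, hu, -, hus, hlu⟩ := hS.exists_rapid s
      obtain ⟨v, hv, -, hvt, hlv⟩ := hS.exists_rapid t
      obtain ⟨n, hn⟩ := hr _ _ (hu.add hv) (hS.o4 u v s t hu hv hlu hlv) le_rfl
      refine (hm hn).trans ?_
      rw [hadd]
      exact add_le_add (hle _ _ (hus n)) (hle _ _ (hvt n))
    · refine ENNReal.biSup_add_biSup_le' (p := fun r => CompactlyContained r s)
        (q := fun r => CompactlyContained r t) ⟨0, compactlyContained_zero _⟩
        ⟨0, compactlyContained_zero _⟩ fun r hr r' hr' => ?_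
      rw [← hadd]
      exact hle _ _ (hS.o3 _ _ _ _ hr hr')
  · exact iSup₂_le fun r hr => hle r t (hr.trans_le hst)
  · refine le_antisymm (iSup₂_le fun r hr => ?_) (iSup_le fun n => iSup₂_le fun r hr =>
      hle r x (hr.trans_le (hx.1 ⟨n, rfl⟩)))
    obtain ⟨r', hr, hr'⟩ := hr.exists_between hS
    obtain ⟨n, hn⟩ := hr' u x hu hx le_rfl
    exact (hle _ _ (hr.trans_le hn)).trans
      (le_iSup (fun n => ⨆ (r : S) (_ : CompactlyContained r (u n)), q r) n)

/-- The pointwise limit q along an ultrafilter is additive and monotone but may fail to preserve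
suprema. Its regularization x satisfies q(s') ≤ x(s) ≤ q(s) for s' ≪ s, which is exactly convergence
to x. -/
theorem SatisfiesO1O5.compactSpace_functional [IsOrderedAddMonoid S] (hS : SatisfiesO1O5 S) :
    CompactSpace (Functional S) := by
  refine ⟨isCompact_iff_ultrafilter_le_nhds.2 fun U _ => ?_⟩
  have hlim : ∀ s : S, ∃ a : ℝ≥0∞, Tendsto (fun x : Functional S => x s) U (𝓝 a) := fun s =>
    ⟨(U.map fun x : Functional S => x s).lim,
      (U.map fun x : Functional S => x s).le_nhds_lim⟩
  choose q hq using hlim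
  obtain ⟨x, hxq, hqx⟩ := exists_functional_le hS (q := q)
    (fun s t hst => le_of_tendsto_of_tendsto' (hq s) (hq t) fun x => x.monotone' hst)
    (tendsto_nhds_unique (hq 0) (tendsto_const_nhds.congr fun x => x.map_zero'.symm))
    (fun s t => tendsto_nhds_unique (hq (s + t))
      (((hq s).add (hq t)).congr fun x => (x.map_add' s t).symm))
  refine ⟨x, mem_univ _, ?_⟩
  have := (Functional.tendsto_nhds_iff hS (l := (U : Filter (Functional S))) (φ := id)
    (f := x)).2 fun s' s h => ⟨(hq s').limsup_eq.le.trans (hqx s' s h),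
      (hxq s).trans (hq s).liminf_eq.ge⟩
  exact this

/-- A strict inequality between functions on `F(S)` lifts to an inequality in `S`. -/
theorem exists_nsmul_le_nsmul [IsOrderedAddMonoid S] (hS : SatisfiesO1O5 S) {s' s t : S}
    (hs : CompactlyContained s' s) {c : ℝ≥0∞} (hc : c < 1)
    (h : ∀ x : Functional S, x s ≤ c * x t) : ∃ n : ℕ, 0 < n ∧ n • s' ≤ n • t := by
  by_contra! hcon
  obtain ⟨q, hm, h0, hadd, ha, hb⟩ := exists_additive_separating hcon
  obtain ⟨x, hxq, hqx⟩ := exists_functional_le hS hm h0 hadd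
  have : (1 : ℝ≥0∞) ≤ c * 1 := calc
    1 ≤ q s' := ha
    _ ≤ x s := hqx _ _ hs
    _ ≤ c * x t := h x
    _ ≤ c * 1 := by gcongr; exact (hxq t).trans hb
  rw [mul_one] at this
  exact this.not_gt hc

end CompactContainment

/-! ### Rational multiples of the functions ŝ. -/

section Ratio

/-- The sequence `k / (k + 1)` in `[0, ∞]`. -/
noncomputable def ratio (k : ℕ) : ℝ≥0∞ := (k : ℝ≥0∞) / (k.succPNat : ℕ)

theorem ratio_add_inv (k : ℕ) : ratio k + ((k.succPNat : ℕ) : ℝ≥0∞)⁻¹ = 1 := by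
  rw [ratio, ← one_div, ENNReal.div_add_div_same]
  exact (congrArg (· / _) (by simp)).trans (ENNReal.div_self (by simp) (by simp))

theorem ratio_eq (k : ℕ) : ratio k = 1 - ((k.succPNat : ℕ) : ℝ≥0∞)⁻¹ :=
  ENNReal.eq_sub_of_add_eq (by simp) (ratio_add_inv k)

theorem ratio_le_one (k : ℕ) : ratio k ≤ 1 := by
  rw [ratio_eq]
  exact tsub_le_self

theorem ratio_ne_top (k : ℕ) : ratio k ≠ ∞ := ((ratio_le_one k).trans_lt ENNReal.one_lt_top).ne

theorem ratio_lt_succ (k : ℕ) : ratio k < ratio (k + 1) := by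
  by_contra! h
  have h2 : (((k + 1).succPNat : ℕ) : ℝ≥0∞)⁻¹ < ((k.succPNat : ℕ) : ℝ≥0∞)⁻¹ :=
    ENNReal.inv_lt_inv.2 (by exact_mod_cast Nat.lt_succ_self _)
  exact (ENNReal.add_lt_add_of_le_of_lt (ratio_ne_top _) h h2).ne
    ((ratio_add_inv (k + 1)).trans (ratio_add_inv k).symm)

theorem ratio_lt_one (k : ℕ) : ratio k < 1 := (ratio_lt_succ k).trans_le (ratio_le_one _)

theorem ratio_mono : Monotone ratio := monotone_nat_of_le_succ fun k => (ratio_lt_succ k).le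

theorem tendsto_ratio : Tendsto ratio atTop (𝓝 1) := by
  have h : Tendsto (fun k : ℕ => (1 : ℝ≥0∞) - ((k.succPNat : ℕ) : ℝ≥0∞)⁻¹) atTop (𝓝 (1 - 0)) :=
    ENNReal.Tendsto.sub tendsto_const_nhds
      (ENNReal.tendsto_inv_nat_nhds_zero.comp (tendsto_add_atTop_nat 1)) (by simp)
  rw [tsub_zero] at h
  exact h.congr fun k => (ratio_eq k).symm

end Ratio

variable {S : Type*} [AddCommMonoid S] [PartialOrder S]

namespace Functional

theorem map_zero (x : Functional S) : x 0 = 0 := x.map_zero'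

theorem map_add (x : Functional S) (s t : S) : x (s + t) = x s + x t := x.map_add' s t

theorem mono (x : Functional S) {s t : S} (h : s ≤ t) : x s ≤ x t := x.monotone' h

theorem map_nsmul (x : Functional S) (k : ℕ) (s : S) : x (k • s) = k * x s := by
  induction k with
  | zero => simp [x.map_zero]
  | succ k ih => rw [succ_nsmul, map_add, ih, Nat.cast_succ, add_mul, one_mul]

theorem map_isLUB (x : Functional S) {u : ℕ → S} {s : S} (hu : Monotone u)
    (hs : IsLUB (range u) s) : x s = ⨆ n, x (u n) := x.map_sup' u s hu hs

theorem isOpen_setOf_exists_lt (s' : S) (b : ℝ≥0∞) :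
    IsOpen {x : Functional S | ∃ s, CompactlyContained s' s ∧ x s < b} :=
  TopologicalSpace.isOpen_generateFrom_of_mem (Or.inr ⟨s', b, rfl⟩)

end Functional

section Hat

/-- The function `ŝ / n` on the cone of functionals. -/
noncomputable def hat (s : S) (n : ℕ+) (x : Functional S) : ℝ≥0∞ := x s / (n : ℝ≥0∞)

theorem hat_nsmul (k : ℕ) (m n : ℕ+) (s : S) (x : Functional S) :
    hat (k • s) (m * n) x = (k : ℝ≥0∞) / (m : ℕ) * hat s n x := by
  rw [hat, hat, x.map_nsmul, PNat.mul_coe, Nat.cast_mul]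
  simp only [div_eq_mul_inv]
  rw [ENNReal.mul_inv (by simp) (by simp)]
  ring

theorem hat_nsmul_cancel (m n : ℕ+) (s : S) : hat ((m : ℕ) • s) (m * n) = hat s n := by
  funext x
  rw [hat_nsmul, ENNReal.div_self (by simp) (by simp), one_mul]

theorem hat_add (s t : S) (n : ℕ+) (x : Functional S) :
    hat (s + t) n x = hat s n x + hat t n x := by
  rw [hat, x.map_add, ENNReal.add_div]
  rfl

theorem hat_mono {s t : S} (h : s ≤ t) (n : ℕ+) (x : Functional S) : hat s n x ≤ hat t n x :=
  ENNReal.div_le_div_right (x.mono h) _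

theorem hat_smul (s : S) (n : ℕ+) (d : ℝ≥0) (x : Functional S) :
    hat s n (d • x) = d * hat s n x := by
  rw [hat, Functional.smul_apply, mul_div_assoc]
  rfl

theorem hat_mem (s : S) (n : ℕ+) : hat s n ∈ realification S :=
  ⟨fun _ => s, fun _ => n, monotone_const, fun x => by simp [hat]⟩

theorem mul_mem_realification {f : Functional S → ℝ≥0∞} (hf : f ∈ realification S) (k : ℕ)
    (m : ℕ+) : (fun x => (k : ℝ≥0∞) / (m : ℕ) * f x) ∈ realification S := by
  obtain ⟨s, n, hmono, hf⟩ := hf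
  have key : ∀ i (x : Functional S), x (k • s i) / ((m * n i : ℕ+) : ℝ≥0∞) =
      (k : ℝ≥0∞) / (m : ℕ) * (x (s i) / (n i : ℝ≥0∞)) := fun i x => hat_nsmul k m (n i) (s i) x
  refine ⟨fun i => k • s i, fun i => m * n i, fun i j hij x => ?_, fun x => ?_⟩
  · simp only [key]
    exact mul_le_mul_right (hmono hij x) _
  · simp only [key, hf, ENNReal.mul_iSup]

theorem tendsto_mul_hat {u : ℕ → S} {s : S} (hu : Monotone u) (hs : IsLUB (range u) s)
    {c : ℕ → ℝ≥0∞} (hc : Tendsto c atTop (𝓝 1)) (n : ℕ+) (x : Functional S) :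
    Tendsto (fun k => c k * hat (u k) n x) atTop (𝓝 (hat s n x)) := by
  have h1 : Tendsto (fun k => x (u k)) atTop (𝓝 (x s)) := by
    rw [x.map_isLUB hu hs]
    exact tendsto_atTop_iSup fun i j h => x.mono (hu h)
  have h2 := ENNReal.Tendsto.mul hc (Or.inl one_ne_zero)
    (ENNReal.Tendsto.div_const h1 (Or.inr (show ((n : ℕ) : ℝ≥0∞) ≠ 0 by simp)))
    (Or.inr ENNReal.one_ne_top)
  rwa [one_mul] at h2

end Hat

/-! ### A concrete form of compact containment on F(S). -/

section WayBelow

/-- A sufficient condition for `f` to be compactly contained in `g` in a set of homogeneous lower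
semicontinuous functions on `F(S)`, see `WayBelow.exists_le`. -/
def WayBelow (f g : Functional S → ℝ≥0∞) : Prop :=
  ∃ c < 1, ∃ f' : Functional S → ℝ≥0∞, (∀ (d : ℝ≥0) x, f' (d • x) = d * f' x) ∧
    (∀ x b, g x < b → ∀ᶠ y in 𝓝 x, f' y < b) ∧ ∀ x, f x ≤ c * f' x

namespace WayBelow

variable {f g f₁ g₁ f₂ g₂ : Functional S → ℝ≥0∞}

theorem trans_le (h : WayBelow f g) (hg : g ≤ g₁) : WayBelow f g₁ := by
  obtain ⟨c, hc, f', hhom, hlim, hle⟩ := h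
  exact ⟨c, hc, f', hhom, fun x b hb => hlim x b ((hg x).trans_lt hb), hle⟩

theorem of_le (hf : f₁ ≤ f) (h : WayBelow f g) : WayBelow f₁ g := by
  obtain ⟨c, hc, f', hhom, hlim, hle⟩ := h
  exact ⟨c, hc, f', hhom, hlim, fun x => (hf x).trans (hle x)⟩

theorem le (h : WayBelow f g) : f ≤ g := by
  obtain ⟨c, hc, f', -, hlim, hle⟩ := h
  intro x
  refine le_of_forall_gt fun b hb => ?_
  calc f x ≤ c * f' x := hle x
    _ ≤ 1 * f' x := by gcongr
    _ < b := by
      rw [one_mul]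
      exact (hlim x b hb).self_of_nhds

theorem add (h₁ : WayBelow f₁ g₁) (h₂ : WayBelow f₂ g₂) : WayBelow (f₁ + f₂) (g₁ + g₂) := by
  obtain ⟨c₁, hc₁, f₁', hhom₁, hlim₁, hle₁⟩ := h₁
  obtain ⟨c₂, hc₂, f₂', hhom₂, hlim₂, hle₂⟩ := h₂
  refine ⟨max c₁ c₂, max_lt hc₁ hc₂, f₁' + f₂', fun d x => ?_, fun x b hb => ?_, fun x => ?_⟩
  · simp only [Pi.add_apply, hhom₁, hhom₂, mul_add]
  · have hb : g₁ x + g₂ x < b := hb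
    obtain ⟨ε, hε, hlt⟩ := ENNReal.lt_iff_exists_add_pos_lt.1 hb
    have hε2 : ((ε / 2 : ℝ≥0) : ℝ≥0∞) ≠ 0 := by
      exact_mod_cast (half_pos hε).ne'
    obtain ⟨ht₁, ht₂⟩ := ENNReal.add_ne_top.1 hb.ne_top
    filter_upwards [hlim₁ x _ (ENNReal.lt_add_right ht₁ hε2),
      hlim₂ x _ (ENNReal.lt_add_right ht₂ hε2)] with y hy₁ hy₂
    refine (add_le_add hy₁.le hy₂.le).trans_lt ?_
    rwa [add_add_add_comm, ← ENNReal.coe_add, add_halves]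
  · calc f₁ x + f₂ x ≤ c₁ * f₁' x + c₂ * f₂' x := add_le_add (hle₁ x) (hle₂ x)
      _ ≤ max c₁ c₂ * f₁' x + max c₁ c₂ * f₂' x := by
        gcongr
        · exact le_max_left _ _
        · exact le_max_right _ _
      _ = max c₁ c₂ * (f₁' + f₂') x := (mul_add _ _ _).symm

/-- The intermediate function is d·â/n with constant c/d; its limit condition comes from the second
family of subbasic open sets of F(S). -/
theorem mul_hat {a b : S} (h : CompactlyContained a b) {c d : ℝ≥0∞} (hcd : c < d) (hd : d ≠ ∞)
    (n : ℕ+) : WayBelow (fun x => c * hat a n x) (fun x => d * hat b n x) := by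
  have hd0 : d ≠ 0 := (zero_le.trans_lt hcd).ne'
  refine ⟨c / d, ?_, fun x => d * hat a n x, fun r x => ?_, fun x B hB => ?_, fun x => ?_⟩
  · rwa [ENNReal.div_lt_iff (Or.inl hd0) (Or.inl hd), one_mul]
  · simp only [hat_smul, mul_left_comm]
  · have hform : ∀ z : ℝ≥0∞, d * (z / (n : ℕ)) < B ↔ z < B / (d / (n : ℕ)) := by
      intro z
      have h0 : d / (n : ℕ) ≠ 0 := ENNReal.div_ne_zero.2 ⟨hd0, by simp⟩
      have h1 : d / (n : ℕ) ≠ ∞ := ENNReal.div_ne_top hd (by simp)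
      rw [ENNReal.lt_div_iff_mul_lt (Or.inl h0) (Or.inl h1)]
      simp only [div_eq_mul_inv, mul_left_comm]
    filter_upwards [(Functional.isOpen_setOf_exists_lt a _).mem_nhds
      ⟨b, h, (hform _).1 hB⟩] with y hy
    obtain ⟨r, har, hr⟩ := hy
    exact (hform _).2 ((y.mono har.le).trans_lt hr)
  · rw [← mul_assoc, ENNReal.div_mul_cancel hd0 hd]

theorem exists_le [IsOrderedAddMonoid S] [IsBotZeroClass S] (hS : SatisfiesO1O5 S)
    (h : WayBelow f g) {u : ℕ → Functional S → ℝ≥0∞} (hu : Monotone u) (huL : ∀ n, u n ∈ Lsc S)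
    (hg : ∀ x, g x ≤ ⨆ n, u n x) : ∃ n, f ≤ u n := by
  obtain ⟨c, hc, f', hhom, hlim, hle⟩ := h
  by_contra! hcon
  have hex : ∀ n, ∃ x : Functional S, 1 ≤ f' x ∧ u n x ≤ c := by
    intro n
    obtain ⟨x, hx⟩ := not_forall.1 (hcon n)
    have hx : u n x < c * f' x := (not_le.1 hx).trans_le (hle x)
    have hc0 : c ≠ 0 := by
      rintro rfl
      simp at hx
    have hct : c ≠ ∞ := hc.ne_top
    have hx' : u n x / c < f' x := by
      rwa [ENNReal.div_lt_iff (Or.inl hc0) (Or.inl hct), mul_comm]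
    obtain ⟨d, hd1, hd2⟩ := ENNReal.lt_iff_exists_nnreal_btwn.1 hx'
    have hd0 : d ≠ 0 := by
      rintro rfl
      simp at hd1
    have hd0' : (d : ℝ≥0∞) ≠ 0 := by exact_mod_cast hd0
    refine ⟨d⁻¹ • x, ?_, ?_⟩
    · rw [hhom, ENNReal.coe_inv hd0, mul_comm, ← div_eq_mul_inv,
        ENNReal.le_div_iff_mul_le (Or.inl hd0') (Or.inl ENNReal.coe_ne_top), one_mul]
      exact hd2.le
    · rw [(huL n).2.2.2 _ _ (by positivity), ENNReal.coe_inv hd0, mul_comm, ← div_eq_mul_inv,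
        ENNReal.div_le_iff_le_mul (Or.inl hd0') (Or.inl ENNReal.coe_ne_top)]
      rw [ENNReal.div_lt_iff (Or.inl hc0) (Or.inl hct)] at hd1
      rw [mul_comm]
      exact hd1.le
  choose y hy1 hy2 using hex
  have := hS.compactSpace_functional
  obtain ⟨x, hx⟩ := exists_clusterPt_of_compactSpace (map y atTop)
  have hx : MapClusterPt x atTop y := hx
  -- If g < 1 at the cluster point, then f' < 1 nearby. Otherwise some u m exceeds c there, hence
  -- nearby by lower semicontinuity.
  by_cases hgx : g x < 1
  · obtain ⟨n, hn⟩ := (hx.frequently (hlim x 1 hgx)).exists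
    exact (hy1 n).not_gt hn
  · obtain ⟨m, hm⟩ := lt_iSup_iff.1 (hc.trans_le ((not_lt.1 hgx).trans (hg x)))
    obtain ⟨n, hn, hmn⟩ := ((hx.frequently ((huL m).1 x c hm)).and_eventually
      (eventually_ge_atTop m)).exists
    exact (hn.trans_le (hu hmn (y n))).not_ge (hy2 n)

end WayBelow

end WayBelow

/-- A diagonal sequence for an increasing sequence of suprema of rapidly increasing sequences. -/
theorem WayBelow.exists_diagonal [IsOrderedAddMonoid S] [IsBotZeroClass S]
    (hS : SatisfiesO1O5 S) {f : ℕ → Functional S → ℝ≥0∞}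
    {h : ℕ → ℕ → Functional S → ℝ≥0∞} (hf : Monotone f) (hL : ∀ m k, h m k ∈ Lsc S)
    (hW : ∀ m k, WayBelow (h m k) (h m (k + 1))) (hsup : ∀ m x, f m x = ⨆ k, h m k x) :
    ∃ φ : ℕ → ℕ, (∀ j, WayBelow (h j (φ j)) (h (j + 1) (φ (j + 1)))) ∧
      ∀ x, ⨆ m, f m x = ⨆ j, h j (φ j) x := by
  have hmono : ∀ m, Monotone (h m) := fun m => monotone_nat_of_le_succ fun k => (hW m k).le
  have hle : ∀ m k, h m k ≤ f m := fun m k x => by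
    rw [hsup]
    exact le_iSup (fun k => h m k x) k
  have hstep : ∀ j K, ∃ K', ∀ a ≤ j, h a K ≤ h (j + 1) K' := by
    intro j K
    have : ∀ a, ∃ K', a ≤ j → h a K ≤ h (j + 1) K' := by
      intro a
      by_cases ha : a ≤ j
      · obtain ⟨K', hK'⟩ := (hW a K).exists_le hS (hmono (j + 1)) (hL (j + 1)) fun x => by
          rw [← hsup]
          exact (hle _ _ x).trans (hf (ha.trans j.le_succ) x)
        exact ⟨K', fun _ => hK'⟩
      · exact ⟨0, fun h => (ha h).elim⟩
    choose ψ hψ using this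
    refine ⟨(Finset.range (j + 1)).sup ψ, fun a ha => (hψ a ha).trans (hmono _ ?_)⟩
    exact Finset.le_sup (f := ψ) (Finset.mem_range_succ_iff.2 ha)
  choose ψ hψ using hstep
  -- In the maximum, φ j + 1 makes the diagonal rapidly increasing, and j makes it dominate every h
  -- m k eventually.
  let φ : ℕ → ℕ := fun j => Nat.rec 0 (fun j r => ψ j (max (r + 1) j)) j
  have hφ : ∀ j a, a ≤ j → h a (max (φ j + 1) j) ≤ h (j + 1) (φ (j + 1)) :=
    fun j a ha => hψ j _ a ha
  refine ⟨φ, fun j => (hW j (φ j)).trans_le ((hmono j (le_max_left _ _)).trans (hφ j j le_rfl)),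
    fun x => le_antisymm (iSup_le fun m => ?_) (iSup_mono fun j => hle j _ x)⟩
  rw [hsup]
  refine iSup_le fun k => ?_
  refine le_trans ?_ (le_iSup (fun j => h j (φ j) x) (max m k + 1))
  exact (hmono m ((le_max_right m k).trans (le_max_right _ _)) x).trans
    (hφ (max m k) m (le_max_left _ _) x)

/-! ### Suprema and compact containment in the realification: O1–O4. -/

section Realification

variable [IsOrderedAddMonoid S] [IsBotZeroClass S]

omit [IsOrderedAddMonoid S] [IsBotZeroClass S] in
theorem hat_mem_Lsc (s : S) (n : ℕ+) : hat s n ∈ Lsc S := realification_le_Lsc S (hat_mem s n)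

/-- Every element of the realification is the supremum of a rapidly increasing sequence `ŝᵢ / nᵢ`. -/
theorem exists_rapid_hat (hS : SatisfiesO1O5 S) {f : Functional S → ℝ≥0∞}
    (hf : f ∈ realification S) : ∃ (s : ℕ → S) (n : ℕ → ℕ+),
      (∀ i, WayBelow (hat (s i) (n i)) (hat (s (i + 1)) (n (i + 1)))) ∧
        ∀ x, f x = ⨆ i, hat (s i) (n i) x := by
  obtain ⟨s, n, hmono, hf⟩ := hf
  choose u hum hu _ hlub using fun i => hS.exists_rapid (s i)
  -- The coefficient increases strictly while u i is rapidly increasing; `WayBelow.mul_hat` needs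
  -- both.
  have hform : ∀ i k, hat (k • u i k) (k.succPNat * n i) =
      fun x => ratio k * hat (u i k) (n i) x := fun i k => funext fun x => hat_nsmul _ _ _ _ x
  obtain ⟨φ, hφ, hsup⟩ := WayBelow.exists_diagonal hS (f := fun i x => x (s i) / (n i : ℝ≥0∞))
    (h := fun i k => hat (k • u i k) (k.succPNat * n i)) hmono (fun _ _ => hat_mem_Lsc _ _)
    (fun i k => by
      simp only [hform]
      exact WayBelow.mul_hat (hu i k) (ratio_lt_succ k) (ratio_ne_top _) _)
    (fun i x => by
      simp only [hform]
      exact (iSup_eq_of_tendsto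
        (fun k l hkl => mul_le_mul' (ratio_mono hkl) (hat_mono (hum i hkl) _ x))
        (tendsto_mul_hat (hum i) (hlub i) tendsto_ratio (n i) x)).symm)
  exact ⟨fun i => φ i • u i (φ i), fun i => (φ i).succPNat * n i, hφ,
    fun x => (hf x).trans (hsup x)⟩

theorem iSup_mem_realification (hS : SatisfiesO1O5 S) {f : ℕ → Functional S → ℝ≥0∞}
    (hf : Monotone f) (hmem : ∀ m, f m ∈ realification S) :
    (fun x => ⨆ m, f m x) ∈ realification S := by
  choose s n hW hsup using fun m => exists_rapid_hat hS (hmem m)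
  obtain ⟨φ, hφ, hsup⟩ := WayBelow.exists_diagonal hS (h := fun m k => hat (s m k) (n m k)) hf
    (fun _ _ => hat_mem_Lsc _ _) hW hsup
  exact ⟨fun j => s j (φ j), fun j => n j (φ j), monotone_nat_of_le_succ fun j => (hφ j).le, hsup⟩

namespace realification

theorem isLUB_iff (hS : SatisfiesO1O5 S) {u : ℕ → realification S} (hu : Monotone u)
    {f : realification S} : IsLUB (range u) f ↔
      ∀ x, (f : Functional S → ℝ≥0∞) x = ⨆ n, (u n : Functional S → ℝ≥0∞) x := by
  let g : realification S := ⟨_, iSup_mem_realification hS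
    (f := fun n => (u n : Functional S → ℝ≥0∞)) (fun i j h => hu h) fun n => (u n).2⟩
  have hg : ∀ h : realification S,
      (∀ x, (h : Functional S → ℝ≥0∞) x = ⨆ n, (u n : Functional S → ℝ≥0∞) x) →
      IsLUB (range u) h := by
    refine fun h hh => ⟨?_, fun k hk x => ?_⟩
    · rintro _ ⟨n, rfl⟩ x
      exact (le_iSup (fun n => (u n : Functional S → ℝ≥0∞) x) n).trans (hh x).ge
    · exact (hh x).trans_le (iSup_le fun n => hk ⟨n, rfl⟩ x)
  refine ⟨fun h x => ?_, hg f⟩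
  rw [h.unique (hg g fun _ => rfl)]

theorem compactlyContained_of_wayBelow (hS : SatisfiesO1O5 S) {f g : realification S}
    (h : WayBelow (f : Functional S → ℝ≥0∞) g) : CompactlyContained f g := by
  intro u x hu hx hgx
  obtain ⟨n, hn⟩ := h.exists_le hS (u := fun n => (u n : Functional S → ℝ≥0∞))
    (fun i j hij => hu hij) (fun n => realification_le_Lsc S (u n).2)
    fun y => (hgx y).trans_eq ((isLUB_iff hS hu).1 hx y)
  exact ⟨n, hn⟩

/-- Compactly contained elements are below terms of approximating sequences. -/
theorem exists_le_of_compactlyContained (hS : SatisfiesO1O5 S) {f g : realification S}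
    (h : CompactlyContained f g) {u : ℕ → Functional S → ℝ≥0∞} (hu : Monotone u)
    (hmem : ∀ n, u n ∈ realification S)
    (hg : ∀ x, (g : Functional S → ℝ≥0∞) x ≤ ⨆ n, u n x) :
    ∃ n, (f : Functional S → ℝ≥0∞) ≤ u n := by
  let v : ℕ → realification S := fun n => ⟨u n, hmem n⟩
  have hv : Monotone v := fun i j h => hu h
  obtain ⟨n, hn⟩ := h v ⟨_, iSup_mem_realification hS hu hmem⟩ hv
    ((isLUB_iff hS hv).2 fun _ => rfl) hg
  exact ⟨n, hn⟩

/-- For the forward direction, a rapidly increasing sequence with supremum g has a term above f, and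
that term is way below the next one. -/
theorem compactlyContained_iff (hS : SatisfiesO1O5 S) {f g : realification S} :
    CompactlyContained f g ↔ WayBelow (f : Functional S → ℝ≥0∞) g := by
  refine ⟨fun h => ?_, compactlyContained_of_wayBelow hS⟩
  obtain ⟨s, n, hW, hsup⟩ := exists_rapid_hat hS g.2
  obtain ⟨i, hi⟩ := exists_le_of_compactlyContained hS h
    (monotone_nat_of_le_succ fun i => (hW i).le) (fun i => hat_mem _ _) fun x => (hsup x).le
  refine ((hW i).of_le hi).trans_le fun x => ?_
  rw [hsup]
  exact le_iSup (fun i => hat (s i) (n i) x) (i + 1)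

theorem exists_isLUB (hS : SatisfiesO1O5 S) (u : ℕ → realification S) (hu : Monotone u) :
    ∃ x, IsLUB (range u) x :=
  ⟨⟨_, iSup_mem_realification hS (f := fun n => (u n : Functional S → ℝ≥0∞))
    (fun _ _ h => hu h) fun n => (u n).2⟩, (isLUB_iff hS hu).2 fun _ => rfl⟩

theorem exists_rapid (hS : SatisfiesO1O5 S) (f : realification S) : ∃ u : ℕ → realification S,
    (∀ n, CompactlyContained (u n) (u (n + 1))) ∧ IsLUB (range u) f := by
  obtain ⟨s, n, hW, hsup⟩ := exists_rapid_hat hS f.2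
  let u : ℕ → realification S := fun i => ⟨_, hat_mem (s i) (n i)⟩
  exact ⟨u, fun i => compactlyContained_of_wayBelow hS (hW i),
    (isLUB_iff hS (monotone_nat_of_le_succ fun i => (hW i).le)).2 hsup⟩

theorem isLUB_add (hS : SatisfiesO1O5 S) {u v : ℕ → realification S} {f g : realification S}
    (hu : Monotone u) (hv : Monotone v) (hf : IsLUB (range u) f) (hg : IsLUB (range v) g) :
    IsLUB (range fun n => u n + v n) (f + g) := by
  refine (isLUB_iff hS fun i j h => add_le_add (hu h) (hv h)).2 fun x => ?_
  have h1 := (isLUB_iff hS hu).1 hf x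
  have h2 := (isLUB_iff hS hv).1 hg x
  simp only [AddSubmonoid.coe_add, Pi.add_apply, h1, h2]
  exact ENNReal.iSup_add_iSup_of_monotone (fun i j h => hu h x) fun i j h => hv h x

end realification

end Realification

/-! ### Axiom O5 for the realification. -/

section AlmostAlgebraicOrder

theorem hat_pow_nsmul (k j : ℕ) (n : ℕ+) (s : S) (x : Functional S) :
    hat (k ^ j • s) (k.succPNat ^ j * n) x = ratio k ^ j * hat s n x := by
  rw [hat_nsmul, ratio, PNat.pow_coe, Nat.cast_pow, Nat.cast_pow, div_eq_mul_inv, div_eq_mul_inv, mul_pow,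
    ENNReal.inv_pow]

theorem CompactlyContained.exists_decreasing (hS : SatisfiesO1O5 S) {a b : S}
    (h : CompactlyContained a b) : ∃ A : ℕ → S, (∀ j, CompactlyContained (A (j + 1)) (A j)) ∧
      (∀ j, CompactlyContained a (A j)) ∧ ∀ j, CompactlyContained (A j) b := by
  have hstep : ∀ r, CompactlyContained a r → ∃ r', CompactlyContained a r' ∧
      CompactlyContained r' r := fun r hr => hr.exists_between hS
  choose ψ h1 h2 using hstep
  let A : ℕ → {r // CompactlyContained a r} :=
    fun j => Nat.rec ⟨ψ b h, h1 b h⟩ (fun _ r => ⟨ψ r.1 r.2, h1 r.1 r.2⟩) j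
  have hA : ∀ j, CompactlyContained (A (j + 1)).1 (A j).1 := fun j => h2 _ _
  refine ⟨fun j => (A j).1, hA, fun j => (A j).2, fun j => ?_⟩
  induction j with
  | zero => exact h2 b h
  | succ j ih => exact (hA j).trans_le ih.le

variable [IsOrderedAddMonoid S] [IsBotZeroClass S]

/-- Almost algebraic order for functions of the form `ŝ / n`. -/
theorem exists_hat_complement (hS : SatisfiesO1O5 S) {a' a t : S} {n m : ℕ+} {c : ℝ≥0∞}
    (ha : CompactlyContained a' a) (hc : c < 1) (hle : ∀ x, hat a n x ≤ c * hat t m x) :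
    ∃ (r : S) (p : ℕ+), ∀ x, hat a' n x + hat r p x ≤ hat t m x ∧
      hat t m x ≤ hat a n x + hat r p x := by
  obtain ⟨b, hab, hba⟩ := ha.exists_between hS
  -- Denominators are cleared so that the inequality lifts to S. O5 is then applied there, and the
  -- complement is divided by N·m·n.
  have hlift : ∀ x : Functional S, x ((m : ℕ) • a) ≤ c * x ((n : ℕ) • t) := by
    intro x
    have h := hle x
    rw [hat, hat, ENNReal.div_le_iff_le_mul (by simp) (by simp)] at h
    rw [x.map_nsmul, x.map_nsmul]
    calc (m : ℝ≥0∞) * x a ≤ m * (c * (x t / (m : ℕ)) * (n : ℕ)) := by gcongr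
      _ = c * ((n : ℕ) * (m * (x t / (m : ℕ)))) := by ring
      _ = _ := by rw [ENNReal.mul_div_cancel (by simp) (by simp)]
  obtain ⟨N, hN, hNle⟩ := exists_nsmul_le_nsmul hS (hba.nsmul hS m) hc hlift
  obtain ⟨r, hr1, hr2⟩ := hS.o5 _ _ _ ((hab.nsmul hS m).nsmul hS N) hNle
  let M : ℕ+ := N.toPNat hN
  have hl : ∀ (s : S) (i j : ℕ+), hat s j = hat (N • ((i : ℕ) • s)) (M * i * j) := by
    intro s i j
    rw [← mul_nsmul']
    exact (hat_nsmul_cancel (M * i) j s).symm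
  have hp : M * n * m = M * m * n := mul_right_comm _ _ _
  refine ⟨r, M * m * n, fun x => ⟨?_, ?_⟩⟩
  · rw [hl a' m n, hl t n m, hp, ← hat_add]
    exact hat_mono hr1 _ x
  · have h1 : hat a n x + hat r (M * m * n) x =
        hat (N • ((m : ℕ) • a) + r) (M * m * n) x := by
      rw [hat_add, hl a m n]
    rw [h1, hl t n m, hp]
    refine hat_mono (hr2.trans ?_) _ x
    gcongr
    exact hba.le

namespace realification

/-- The power j stores several factors below 1, to be spent one at a time on steps that need a
strict inequality. -/
theorem exists_ratio_hat (hS : SatisfiesO1O5 S) {f g : realification S}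
    (h : CompactlyContained f g) (j : ℕ) : ∃ (a b : S) (n : ℕ+) (k : ℕ), CompactlyContained a b ∧
      (∀ x, (f : Functional S → ℝ≥0∞) x ≤ ratio k ^ j * hat a n x) ∧
        ∀ x, hat b n x ≤ (g : Functional S → ℝ≥0∞) x := by
  obtain ⟨s, n, hW, hsup⟩ := exists_rapid_hat hS g.2
  obtain ⟨i, hi⟩ := exists_le_of_compactlyContained hS h
    (monotone_nat_of_le_succ fun i => (hW i).le) (fun i => hat_mem _ _) fun x => (hsup x).le
  have hfb : CompactlyContained f ⟨_, hat_mem (s (i + 1)) (n (i + 1))⟩ :=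
    compactlyContained_of_wayBelow hS ((hW i).of_le hi)
  obtain ⟨u, hum, hu, hub, hlub⟩ := hS.exists_rapid (s (i + 1))
  have hform : ∀ k, hat (k ^ j • u k) (k.succPNat ^ j * n (i + 1)) =
      fun x => ratio k ^ j * hat (u k) (n (i + 1)) x :=
    fun k => funext fun x => hat_pow_nsmul _ _ _ _ x
  have hvm : Monotone fun k x => ratio k ^ j * hat (u k) (n (i + 1)) x := fun k l hkl x =>
    mul_le_mul' (pow_le_pow_left' (ratio_mono hkl) j) (hat_mono (hum hkl) _ x)
  have hlim : Tendsto (fun k => ratio k ^ j) atTop (𝓝 1) := by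
    have := ((ENNReal.continuous_pow j).tendsto 1).comp tendsto_ratio
    rwa [one_pow] at this
  obtain ⟨k, hk⟩ := exists_le_of_compactlyContained hS hfb hvm
    (fun k => by
      rw [← hform]
      exact hat_mem _ _)
    fun x => (iSup_eq_of_tendsto (fun k l hkl => hvm hkl x)
      (tendsto_mul_hat hum hlub hlim _ x)).ge
  refine ⟨u k, s (i + 1), n (i + 1), k, hub k, hk, fun x => ?_⟩
  rw [hsup]
  exact le_iSup (fun i => hat (s i) (n i) x) (i + 1)

theorem exists_complement (hS : SatisfiesO1O5 S) {f' f g : realification S}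
    (h : CompactlyContained f' f) (hfg : f ≤ g) : ∃ r, f' + r ≤ g ∧ g ≤ f + r := by
  -- Write ρ for `ratio k`. One factor of ρ puts ρ·Â₀/n way below g, one leaves the part (1 -
  -- ρ)·t̂ⱼ/mⱼ aside, and one is the constant c in `exists_hat_complement`.
  obtain ⟨a, b, n, k, hab, hf', hbf⟩ := exists_ratio_hat hS h 3
  obtain ⟨A, hA, haA, hAb⟩ := hab.exists_decreasing hS
  have hA0 : ∀ j x, hat (A j) n x ≤ hat (A 0) n x := fun j x =>
    hat_mono (antitone_nat_of_succ_le (fun j => (hA j).le) (Nat.zero_le j)) n x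
  obtain ⟨t₀, m₀, hmono₀, hsup₀⟩ := g.2
  have hW : WayBelow (fun x => ratio k * hat (A 0) n x) (g : Functional S → ℝ≥0∞) :=
    (WayBelow.mul_hat (hAb 0) (ratio_lt_one k) ENNReal.one_ne_top n).trans_le fun x => by
      simp only [one_mul]
      exact (hbf x).trans (hfg x)
  obtain ⟨j₀, hj₀⟩ := hW.exists_le hS hmono₀ (fun j => hat_mem_Lsc (t₀ j) (m₀ j))
    fun x => (hsup₀ x).le
  obtain ⟨t, m, hmono, hsup, hle⟩ : ∃ (t : ℕ → S) (m : ℕ → ℕ+),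
      (Monotone fun j => hat (t j) (m j)) ∧
      (∀ x, (g : Functional S → ℝ≥0∞) x = ⨆ j, hat (t j) (m j) x) ∧
      ∀ j x, ratio k * hat (A j) n x ≤ hat (t j) (m j) x := by
    refine ⟨fun j => t₀ (j + j₀), fun j => m₀ (j + j₀), fun i j hij => hmono₀ (by gcongr),
      fun x => ?_, fun j x => ?_⟩
    · rw [hsup₀]
      exact (Monotone.iSup_nat_add (f := fun j => hat (t₀ j) (m₀ j) x)
        (fun i j hij => hmono₀ hij x) j₀).symm
    · calc ratio k * hat (A j) n x ≤ ratio k * hat (A 0) n x := by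
            gcongr
            exact hA0 j x
        _ ≤ hat (t₀ j₀) (m₀ j₀) x := hj₀ x
        _ ≤ _ := hmono₀ (Nat.le_add_left j₀ j) x
  have hcompl : ∀ j, ∃ (r : S) (p : ℕ+), ∀ x,
      ratio k ^ 3 * hat (A (j + 1)) n x + hat r p x ≤ ratio k * hat (t j) (m j) x ∧
        ratio k * hat (t j) (m j) x ≤ ratio k ^ 3 * hat (A j) n x + hat r p x := by
    intro j
    obtain ⟨r, p, hrp⟩ := exists_hat_complement hS (a' := k ^ 3 • A (j + 1)) (a := k ^ 3 • A j)
      (t := k ^ 1 • t j) (n := k.succPNat ^ 3 * n) (m := k.succPNat ^ 1 * m j) (c := ratio k)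
      ((hA j).nsmul hS _) (ratio_lt_one k) (fun x => by
        rw [hat_pow_nsmul, hat_pow_nsmul, pow_one]
        calc ratio k ^ 3 * hat (A j) n x = ratio k * (ratio k * (ratio k * hat (A j) n x)) := by
              ring
          _ ≤ _ := by
            gcongr
            exact hle j x)
    refine ⟨r, p, fun x => ?_⟩
    have h := hrp x
    simp only [hat_pow_nsmul] at h
    rwa [pow_one] at h
  choose r p hrp using hcompl
  have hη : ratio k + ((1 : ℕ) : ℝ≥0∞) / (k.succPNat : ℕ) = 1 := by
    rw [Nat.cast_one, one_div]
    exact ratio_add_inv k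
  have hη0 : ((1 : ℕ) : ℝ≥0∞) / (k.succPNat : ℕ) ≠ 0 := ENNReal.div_ne_zero.2 ⟨by simp, by simp⟩
  have hmem : ∀ j, (fun x => ((1 : ℕ) : ℝ≥0∞) / (k.succPNat : ℕ) * hat (t j) (m j) x) ∈
      realification S := fun j => mul_mem_realification (hat_mem (t j) (m j)) 1 k.succPNat
  generalize ((1 : ℕ) : ℝ≥0∞) / (k.succPNat : ℕ) = η at hη hη0 hmem
  -- Adding the reserved part η·t̂ⱼ/mⱼ, with η = 1 - ρ, makes R j infinite wherever t̂ⱼ is; this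
  -- replaces cancellation at infinite values.
  let R : ℕ → Functional S → ℝ≥0∞ := fun j =>
    hat (r j) (p j) + fun x => η * hat (t j) (m j) x
  have hRmem : ∀ j, R j ∈ realification S := fun j =>
    (realification S).add_mem (hat_mem _ _) (hmem j)
  have hone : ∀ z : ℝ≥0∞, z = ratio k * z + η * z := fun z => by
    rw [← add_mul, hη, one_mul]
  have hR1 : ∀ j x, ratio k ^ 3 * hat (A (j + 1)) n x + R j x ≤ hat (t j) (m j) x := by
    intro j x
    conv_rhs => rw [hone (hat (t j) (m j) x)]
    simp only [R, Pi.add_apply]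
    rw [← add_assoc]
    gcongr
    exact (hrp j x).1
  have hR2 : ∀ j x, hat (t j) (m j) x ≤ ratio k ^ 3 * hat (A j) n x + R j x := by
    intro j x
    conv_lhs => rw [hone (hat (t j) (m j) x)]
    simp only [R, Pi.add_apply]
    rw [← add_assoc]
    gcongr
    exact (hrp j x).2
  have hRmono : Monotone R := by
    refine monotone_nat_of_le_succ fun j x => ?_
    -- The same term with A (j + 1) occurs at both ends because the upper element of step j + 1 is
    -- the lower one of step j; cancelling it gives R j ≤ R (j + 1).
    have hchain := (hR1 j x).trans ((hmono j.le_succ x).trans (hR2 (j + 1) x))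
    by_cases htop : ratio k ^ 3 * hat (A (j + 1)) n x = ∞
    · have h1 : ratio k * hat (A (j + 1)) n x = ∞ := by
        by_contra hne
        refine ENNReal.mul_ne_top (ENNReal.pow_ne_top (ratio_ne_top k) (n := 2)) hne ?_
        rw [← htop]
        ring
      have h2 : hat (t (j + 1)) (m (j + 1)) x = ∞ :=
        top_le_iff.1 (h1.symm.trans_le (hle (j + 1) x))
      have h3 : R (j + 1) x = ∞ := by
        simp only [R, Pi.add_apply, h2, ENNReal.mul_top hη0, add_top]
      rw [h3]
      exact le_top
    · exact (ENNReal.add_le_add_iff_left htop).1 hchain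
  refine ⟨⟨_, iSup_mem_realification hS hRmono hRmem⟩, fun x => ?_, fun x => ?_⟩
  · change (f' : Functional S → ℝ≥0∞) x + ⨆ j, R j x ≤ (g : Functional S → ℝ≥0∞) x
    rw [ENNReal.add_iSup, hsup]
    refine iSup_mono fun j => le_trans ?_ (hR1 j x)
    gcongr
    exact (hf' x).trans (mul_le_mul_right (hat_mono (haA (j + 1)).le n x) _)
  · change (g : Functional S → ℝ≥0∞) x ≤ (f : Functional S → ℝ≥0∞) x + ⨆ j, R j x
    rw [hsup]
    refine iSup_le fun j => (hR2 j x).trans (add_le_add ?_ (le_iSup (fun j => R j x) j))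
    calc ratio k ^ 3 * hat (A j) n x ≤ 1 * hat (A j) n x := by
          gcongr
          exact pow_le_one' (ratio_le_one k) 3
      _ ≤ hat b n x := by
          rw [one_mul]
          exact hat_mono (hAb j).le n x
      _ ≤ _ := hbf x

theorem satisfiesO1O5 (hS : SatisfiesO1O5 S) : SatisfiesO1O5 (realification S) where
  o1 := exists_isLUB hS
  o2 := exists_rapid hS
  o3 f₁ g₁ f₂ g₂ h₁ h₂ := by
    rw [compactlyContained_iff hS] at h₁ h₂ ⊢
    exact h₁.add h₂
  o4 _ _ _ _ hu hv hf hg := isLUB_add hS hu hv hf hg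
  o5 _ _ _ := exists_complement hS

end realification

end AlmostAlgebraicOrder

/-! ### The homeomorphism between F(S) and the functionals on the realification. -/

section Extension

variable [IsOrderedAddMonoid S] [IsBotZeroClass S]

/-- Evaluation at `x`, as a functional on the realification. -/
noncomputable def Functional.extend (hS : SatisfiesO1O5 S) (x : Functional S) :
    Functional (realification S) where
  toFun f := (f : Functional S → ℝ≥0∞) x
  map_zero' := rfl
  map_add' _ _ := rfl
  monotone' _ _ h := h x
  map_sup' _ _ hu hf := (realification.isLUB_iff hS hu).1 hf x

/-- The restriction of a functional along `s ↦ ŝ`. -/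
noncomputable def Functional.restrict (hS : SatisfiesO1O5 S) (y : Functional (realification S)) :
    Functional S where
  toFun s := y ⟨hat s 1, hat_mem s 1⟩
  map_zero' := by
    rw [← y.map_zero]
    congr 1
    exact Subtype.ext (funext fun x => by simp [hat, x.map_zero])
  map_add' s t := by
    rw [← y.map_add]
    congr 1
    exact Subtype.ext (funext fun x => hat_add s t 1 x)
  monotone' s t h := y.mono fun x => hat_mono h 1 x
  map_sup' u s hu hs := by
    have hmono : Monotone fun n => (⟨hat (u n) 1, hat_mem (u n) 1⟩ : realification S) :=
      fun i j h x => hat_mono (hu h) 1 x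
    refine y.map_isLUB hmono ((realification.isLUB_iff hS hmono).2 fun x => ?_)
    simp [hat, x.map_isLUB hu hs]

theorem Functional.restrict_extend (hS : SatisfiesO1O5 S) (x : Functional S) :
    (x.extend hS).restrict hS = x :=
  DFunLike.ext _ _ fun s => show hat s 1 x = x s by simp [hat]

theorem Functional.apply_hat (hS : SatisfiesO1O5 S) (y : Functional (realification S)) (s : S)
    (n : ℕ+) : y ⟨hat s n, hat_mem s n⟩ = hat s n (y.restrict hS) := by
  have h : (n : ℕ) • (⟨hat s n, hat_mem s n⟩ : realification S) = ⟨hat s 1, hat_mem s 1⟩ := by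
    refine Subtype.ext (funext fun x => ?_)
    change ((n : ℕ) • hat s n) x = hat s 1 x
    rw [Pi.smul_apply, nsmul_eq_mul, hat, hat, ENNReal.mul_div_cancel (by simp) (by simp)]
    simp
  have h' := y.map_nsmul n ⟨hat s n, hat_mem s n⟩
  rw [h] at h'
  exact (ENNReal.eq_div_iff (by simp) (by simp)).2 h'.symm

theorem Functional.extend_restrict (hS : SatisfiesO1O5 S) (y : Functional (realification S)) :
    (y.restrict hS).extend hS = y := by
  refine DFunLike.ext _ _ fun f => ?_
  obtain ⟨s, n, hmono, hf⟩ := f.2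
  have hm : Monotone fun i => (⟨hat (s i) (n i), hat_mem _ _⟩ : realification S) :=
    fun i j h => hmono h
  rw [y.map_isLUB hm ((realification.isLUB_iff hS hm).2 hf)]
  simp only [y.apply_hat hS]
  exact hf _

/-- Subbasic sets of the first kind are open by lower semicontinuity of f; for the second kind, the
intermediate function of `WayBelow` supplies the upper bound near x. -/
theorem Functional.continuous_extend (hS : SatisfiesO1O5 S) :
    Continuous (Functional.extend hS) := by
  refine continuous_generateFrom_iff.2 ?_
  rintro _ (⟨f, a, rfl⟩ | ⟨f, b, rfl⟩)
  · exact (realification_le_Lsc S f.2).1.isOpen_preimage a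
  · rw [isOpen_iff_mem_nhds]
    rintro x ⟨g, hfg, hx⟩
    obtain ⟨g', hfg', hg'⟩ := hfg.exists_between (realification.satisfiesO1O5 hS)
    obtain ⟨c, hc, k, -, hlim, hle⟩ := (realification.compactlyContained_iff hS).1 hg'
    filter_upwards [hlim x b hx] with y hy
    refine ⟨g', hfg', ((hle y).trans (mul_le_of_le_one_left zero_le hc.le)).trans_lt hy⟩

theorem Functional.continuous_restrict (hS : SatisfiesO1O5 S) :
    Continuous (Functional.restrict hS) := by
  refine continuous_generateFrom_iff.2 ?_
  rintro _ (⟨s, a, rfl⟩ | ⟨s', b, rfl⟩)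
  · exact TopologicalSpace.isOpen_generateFrom_of_mem (Or.inl ⟨⟨hat s 1, hat_mem s 1⟩, a, rfl⟩)
  · rw [isOpen_iff_mem_nhds]
    rintro y ⟨s, hs, hy⟩
    obtain ⟨s'', hs', hs''⟩ := hs.exists_between hS
    -- The slack is needed because `WayBelow.mul_hat` only puts a multiple of ŝ'' by a factor below
    -- 1 under ŝ; the factor cancels at the end.
    obtain ⟨k, hk⟩ : ∃ k, y.restrict hS s < ratio k * b := by
      have hlim : Tendsto (fun k => ratio k * b) atTop (𝓝 (1 * b)) :=
        ENNReal.Tendsto.mul_const tendsto_ratio (Or.inl one_ne_zero)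
      rw [one_mul] at hlim
      exact (hlim.eventually_const_lt hy).exists
    have hk0 : ratio k ≠ 0 := by
      intro h0
      simp [h0] at hk
    have hcc : CompactlyContained
        (⟨_, mul_mem_realification (hat_mem s'' 1) k k.succPNat⟩ : realification S)
        ⟨hat s 1, hat_mem s 1⟩ := by
      refine realification.compactlyContained_of_wayBelow hS ?_
      have := WayBelow.mul_hat hs'' (ratio_lt_one k) ENNReal.one_ne_top 1
      simp only [one_mul] at this
      exact this
    filter_upwards [(Functional.isOpen_setOf_exists_lt _ (ratio k * b)).mem_nhds ⟨_, hcc, hk⟩] with z hz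
    obtain ⟨g, hg, hzg⟩ := hz
    refine ⟨s'', hs', ?_⟩
    have h1 : ratio k * z.restrict hS s'' < ratio k * b := by
      refine lt_of_le_of_lt (le_of_eq_of_le ?_ (z.mono hg.le)) hzg
      conv_rhs => rw [← z.extend_restrict hS]
      change _ = ratio k * hat s'' 1 (z.restrict hS)
      simp [hat]
    exact (ENNReal.mul_lt_mul_iff_right hk0 (ratio_ne_top k)).1 h1

end Extension

end CuSemigroup

theorem proposition3p1 {S : Type*} [AddCommMonoid S] [PartialOrder S] [IsOrderedAddMonoid S]
    [IsBotZeroClass S] (hS : CuSemigroup.SatisfiesO1O5 S) :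
    CuSemigroup.SatisfiesO1O5 (CuSemigroup.realification S) ∧
      ∃ e : CuSemigroup.Functional S ≃L[ℝ≥0]
          CuSemigroup.Functional (CuSemigroup.realification S),
        ∀ (x : CuSemigroup.Functional S) (f : CuSemigroup.realification S),
          e x f = (f : CuSemigroup.Functional S → ℝ≥0∞) x := by
  refine ⟨CuSemigroup.realification.satisfiesO1O5 hS,
    { toFun := CuSemigroup.Functional.extend hS
      invFun := CuSemigroup.Functional.restrict hS
      left_inv := CuSemigroup.Functional.restrict_extend hS
      right_inv := CuSemigroup.Functional.extend_restrict hS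
      continuous_toFun := CuSemigroup.Functional.continuous_extend hS
      continuous_invFun := CuSemigroup.Functional.continuous_restrict hS
      map_add' := fun x y => DFunLike.ext _ _ fun f =>
        (CuSemigroup.realification_le_Lsc S f.2).2.2.1 x y
      map_smul' := fun c x => DFunLike.ext _ _ fun f => ?_ }, fun _ _ => rfl⟩
  have hf := CuSemigroup.realification_le_Lsc S f.2
  -- Homogeneity in `Lsc` covers positive scalars only; for c = 0 the vanishing at the zero
  -- functional is used.
  rcases eq_zero_or_pos c with rfl | hc
  · rw [RingHom.id_apply, zero_smul, zero_smul]
    exact hf.2.1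
  · exact hf.2.2.2 c x hc
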